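/- Let $\Gamma=(V,E)$ be an undirected graph, possibly with self-loops. Its graph monoid $\mathbb{M}_\Gamma$ is the monoid generated by the letters $v,\bar v$ for $v\in V$, subject to the relations $v\bar v=1$ for $v\in V$, and $xy=yx$ whenever $x\in\{u,\bar u\}$, $y\in\{v,\bar v\}$ and $\{u,v\}\in E$ (where $u=v$ if the edge is a self-loop). For a word $w\in(V\cup\bar V)^*$ let $[w]\in\mathbb{M}_\Gamma$ be the element it represents. A game arena over $\Gamma$ consists of a finite set of states $Q=Q_\exists\sqcup Q_\forall$, a finite set of transitions $\delta\subseteq Q\times(V\cup\bar V)^*\times Q$, and an initial state $q_{init}\in Q$, such that every state has at least one outgoing transition and for all $p,q\in Q$ there is at most one transition from $p$ to $q$. A transition $(p,w,q)$ induces steps $(p,x)\to(q,x[w])$ between configurations in $Q\times\mathbb{M}_\Gamma$. A configuration $(q,x)$ is valid if $x$ is right-invertible in $\mathbb{M}_\Gamma$. In the non-termination game, a play is a finite or infinite run that starts in $(q_{init},1)$ and visits only valid configurations. The owner of the current state chooses the next transition. An $\exists$-strategy is a map $\sigma\colon Q^*Q_\exists\to Q$ such that for each $wq$ there is a transition from $q$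 to $\sigma(wq)$. The existential player wins if she has a strategy such that every maximal play compliant with it is infinite; here a finite compliant play is maximal if it has no extension to a longer compliant play (so plays that get stuck are won by the universal player). Let $\Gamma$ be the graph with three vertices $a,b_0,b_1$, where $a$ is isolated and has no self-loop, and $b_0,b_1$ are adjacent and each carry a self-loop. (Valence systems over $\Gamma$ are pushdown systems with one stack letter $a$ in which every stack entry carries a vector in $\mathbb{Z}^2$; $a$ can be popped only if the topmost vector is $0$.) Then the following problem is undecidable: given a game arena over $\Gamma$, does the existential player win the non-termination game? -/

import Mathlib

/-- An undirected graph in which self-loops are allowed. -/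
structure LoopGraph (V : Type) where
  Adj : V → V → Prop
  symm : ∀ u v, Adj u v → Adj v u

/-- The letters `v` and `v̄` for each vertex `v`: the pair `(v, true)` is the letter `v`,
the pair `(v, false)` is the barred letter `v̄`. -/
abbrev StorageLetter (V : Type) : Type := V × Bool

/-- The defining relations of the graph monoid: `v v̄ = 1` for every vertex `v`, and letters
belonging to adjacent vertices commute (in particular `v v̄ = v̄ v` if `v` has a self-loop). -/
inductive GraphMonoidRel {V : Type} (Γ : LoopGraph V) :
    FreeMonoid (StorageLetter V) → FreeMonoid (StorageLetter V) → Prop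
  | cancel (v : V) :
      GraphMonoidRel Γ (FreeMonoid.of (v, true) * FreeMonoid.of (v, false)) 1
  | comm (u v : V) (s t : Bool) (h : Γ.Adj u v) :
      GraphMonoidRel Γ (FreeMonoid.of (u, s) * FreeMonoid.of (v, t))
        (FreeMonoid.of (v, t) * FreeMonoid.of (u, s))

/-- The graph monoid of `Γ`. -/
abbrev GraphMonoid {V : Type} (Γ : LoopGraph V) : Type :=
  PresentedMonoid (GraphMonoidRel Γ)

/-- The element of the graph monoid represented by a word over the storage letters. -/
def storageElement {V : Type} (Γ : LoopGraph V) (w : List (StorageLetter V)) : GraphMonoid Γ :=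
  PresentedMonoid.mk (GraphMonoidRel Γ) (FreeMonoid.ofList w)

/-- Right-invertible elements of a monoid; these are the valid storage contents. -/
def RightInvertible {M : Type} [Monoid M] (x : M) : Prop :=
  ∃ y : M, x * y = 1

/-- A valence game arena with storage letters from `V`: a finite set of states, each belonging to
one of the two players, finitely many transitions labelled by words over the storage letters, and
an initial state. Every state has an outgoing transition, and between any two states there is at
most one transition. -/
structure GameArena (V : Type) where
  numStates : ℕ
  /-- `true` for the states of the existential player, `false` for those of the universal one. -/
  existential : Fin numStates → Bool
  /-- The finite set of transitions, given as a list. -/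
  transitions : List (Fin numStates × List (StorageLetter V) × Fin numStates)
  init : Fin numStates
  exists_transition : ∀ p, ∃ w q, (p, w, q) ∈ transitions
  transition_unique : ∀ p q w w',
    (p, w, q) ∈ transitions → (p, w', q) ∈ transitions → w = w'

namespace GameArena

variable {V : Type}

/-- Configurations: a control state together with a storage content. -/
abbrev Conf (A : GameArena V) (Γ : LoopGraph V) : Type :=
  Fin A.numStates × GraphMonoid Γ

/-- One step of the valence system: take a transition and multiply its label from the right. -/
def Step (A : GameArena V) (Γ : LoopGraph V) (c d : A.Conf Γ) : Prop :=
  ∃ w, (c.1, w, d.1) ∈ A.transitions ∧ d.2 = c.2 * storageElement Γ w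

/-- The finite plays of the non-termination game that start in `c`: finite runs that visit only
valid configurations. -/
def IsFinitePlay (A : GameArena V) (Γ : LoopGraph V) (c : A.Conf Γ) (π : List (A.Conf Γ)) :
    Prop :=
  π.head? = some c ∧ π.IsChain (A.Step Γ) ∧ ∀ d ∈ π, RightInvertible d.2

/-- Strategies of the existential player: maps sending every nonempty sequence of states that ends
in a state of the existential player to a successor state. (The values at all other sequences are
irrelevant.) -/
def IsStrategy (A : GameArena V) (σ : List (Fin A.numStates) → Fin A.numStates) : Prop :=
  ∀ (h : List (Fin A.numStates)) (q : Fin A.numStates), A.existential q = true →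
    ∃ w, (q, w, σ (h ++ [q])) ∈ A.transitions

/-- A finite sequence of configurations is compliant with `σ` if `σ` chooses the next state
whenever a state of the existential player has a successor in the sequence. -/
def Compliant (A : GameArena V) (Γ : LoopGraph V)
    (σ : List (Fin A.numStates) → Fin A.numStates) (π : List (A.Conf Γ)) : Prop :=
  ∀ (h : List (A.Conf Γ)) (c d : A.Conf Γ), h ++ [c, d] <+: π → A.existential c.1 = true →
    σ ((h ++ [c]).map Prod.fst) = d.1

/-- `σ` wins for the existential player from `c` if every maximal play that starts in `c` and is
compliant with `σ` is infinite, that is, every finite one can be prolonged. -/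
def IsWinningStrategy (A : GameArena V) (Γ : LoopGraph V) (c : A.Conf Γ)
    (σ : List (Fin A.numStates) → Fin A.numStates) : Prop :=
  A.IsStrategy σ ∧
    ∀ π, A.IsFinitePlay Γ c π → A.Compliant Γ σ π →
      ∃ d, A.IsFinitePlay Γ c (π ++ [d]) ∧ A.Compliant Γ σ (π ++ [d])

/-- The existential player wins the non-termination game over `Γ` from the initial state with
empty storage. -/
def ExistentialWins (A : GameArena V) (Γ : LoopGraph V) : Prop :=
  ∃ σ, A.IsWinningStrategy Γ (A.init, 1) σ

/-- The description of an arena as a finite object, on which algorithms operate: the owners of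
the states in order, the transitions, and the initial state. -/
def code (A : GameArena V) : List Bool × List (ℕ × List (StorageLetter V) × ℕ) × ℕ :=
  (List.ofFn A.existential,
    A.transitions.map (fun t => ((t.1 : ℕ), t.2.1, (t.2.2 : ℕ))),
    (A.init : ℕ))

end GameArena

/-- Non-termination games over `Γ` are decidable: some algorithm decides, given an arena, whether
the existential player wins. -/
def NonTerminationGamesDecidable {V : Type} [Primcodable V] (Γ : LoopGraph V) : Prop :=
  ∃ f : List Bool × List (ℕ × List (StorageLetter V) × ℕ) × ℕ → Bool,
    Computable f ∧ ∀ A : GameArena V, f A.code = true ↔ A.ExistentialWins Γ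

/-- The graph with an isolated unlooped vertex `0` (the pushdown letter) and two adjacent, looped
vertices `1` and `2` (generating the group `ℤ²`). -/
def pdZ2Graph : LoopGraph (Fin 3) where
  Adj u v := u ≠ 0 ∧ v ≠ 0
  symm _ _ h := ⟨h.2, h.1⟩

/-!
The universal player tries to make the play get stuck, so he can take the part of a prover: he
wins if he can prove that a fixed Turing machine halts on a given input. Only storage contents
`a u` with a single stack entry `u = (t, p) ∈ ℤ²` are needed.

A Turing machine is simulated by a one-dimensional cellular automaton, and the prover claims that
the cell at time `t` and position `p` contains a halting symbol. To prove that a cell at time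
`t + 1` contains `s`, he names the symbols of the three cells at time `t` that determine it, and the
existential player picks the one of the three claims that has to be proved next. At time `0` the
claim is about the initial row, and it reduces to `t = 0` and linear inequalities for `p`. These are
proved by moving `u` to `0` in steps of fixed sign and popping `a`, which is possible only at
`u = 0`. Afterwards the stack is empty, and a second pop gets the play stuck. A prover who cannot
complete his proof has to play on forever. So the space-time diagram is never stored: it suffices
to remember one of its points, and alternation does the rest.

The machine is fixed and only its input varies, which keeps the reduction simple. Mathlib's
compilation of partial recursive functions to Turing machines writes numbers in binary, and the
inputs `2 ^ m - 1` are unary words. Hence only two labels of the arena depend on `m`, and they are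
powers of a letter. The initial row consists of a symbol at the origin, a block of length `m` to its
right, and blanks elsewhere.

The main steps are `Turing.TM0.exists_not_computablePred_eval_dom` (the machine),
`exists_cellularRow_not_computablePred` (the automaton), `TraceState.accepts_start_iff` (the proof
game as an alternating vector addition system), `AlternatingSystem.existentialWins_arena_iff` (its
arena), which rests on `GameArena.existentialWins_iff` (determinacy) and on
`rightInvertible_stackElement_mul_pop` (a pop is valid only at `0`), and
`GameArena.primrec_code_ofLabels` (computability of the reduction).
-/

/-! ### A Turing machine with undecidable halting problem on unary inputs -/

open Turing in
theorem Turing.PartrecToTM2.trNat_two_pow_sub_one (m : ℕ) :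
    PartrecToTM2.trNat (2 ^ m - 1) = List.replicate m PartrecToTM2.Γ'.bit1 := by
  have key : ∀ k : ℕ, PartrecToTM2.trNat (2 * k + 1) =
      PartrecToTM2.Γ'.bit1 :: PartrecToTM2.trNat k := by
    intro k
    have h : ((2 * k + 1 : ℕ) : Num) = Num.bit1 (k : Num) := by
      apply Num.to_nat_inj.1
      rw [Num.cast_bit1, Num.to_of_nat, Num.to_of_nat, two_mul]
    rw [PartrecToTM2.trNat, PartrecToTM2.trNat, h]
    cases (k : Num) <;> rfl
  induction m with
  | zero => simp
  | succ m ih =>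
    have : 2 ^ (m + 1) - 1 = 2 * (2 ^ m - 1) + 1 := by
      have := Nat.one_le_two_pow (n := m)
      omega
    rw [this, key, ih, List.replicate_succ]

open Turing in
/-- The tape alphabet of the emulator of a stack machine has two symbols `x` and `y` such that the
input `2 ^ m - 1` is written on the tape as `x y ⋯ y` with `m` letters `y`. -/
theorem Turing.PartrecToTM2.exists_trInit_trList_two_pow_sub_one :
    ∃ x y : TM2to1.Γ' PartrecToTM2.K' (fun _ => PartrecToTM2.Γ'), ∀ m : ℕ,
      TM2to1.trInit PartrecToTM2.K'.main (PartrecToTM2.trList [2 ^ m - 1]) =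
        x :: List.replicate m y := by
  refine ⟨(true, Function.update (fun _ => none) PartrecToTM2.K'.main (some PartrecToTM2.Γ'.cons)),
    (false, Function.update (fun _ => none) PartrecToTM2.K'.main (some PartrecToTM2.Γ'.bit1)),
    fun m => ?_⟩
  have h : (PartrecToTM2.trList [2 ^ m - 1]).reverse =
      PartrecToTM2.Γ'.cons :: List.replicate m PartrecToTM2.Γ'.bit1 := by
    simp [PartrecToTM2.trNat_two_pow_sub_one]
  unfold TM2to1.trInit
  rw [h]
  exact congrArg (List.cons _) List.map_replicate

/-- Some partial recursive function has an undecidable domain already when restricted to the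
numbers `2 ^ m - 1`, whose binary expansion is the unary word of length `m`. -/
theorem exists_partrec_not_computablePred_two_pow :
    ∃ f : ℕ →. ℕ, Partrec f ∧ ¬ ComputablePred fun m : ℕ => (f (2 ^ m - 1)).Dom := by
  classical
  -- The witness recovers `k` from `2 ^ k - 1` and runs the `k`-th program on the input `0`.
  let u : ℕ →. ℕ := fun n => (Denumerable.ofNat Nat.Partrec.Code n).eval 0
  have hu : Partrec u :=
    Nat.Partrec.Code.eval_part.comp (Computable.ofNat _) (Computable.const 0)
  let l : ℕ →. ℕ := fun x => Nat.rfind fun k => Part.some (decide (2 ^ k - 1 = x))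
  have hpow : Primrec (fun k : ℕ => 2 ^ k) :=
    (Primrec₂.unpaired'.1 Nat.Primrec.pow).comp (Primrec.const 2) Primrec.id
  have hl : Partrec l := by
    refine Partrec.rfind (p := fun x k => Part.some (decide (2 ^ k - 1 = x))) ?_
    refine Computable.partrec (f := fun q : ℕ × ℕ => decide (2 ^ q.2 - 1 = q.1)) ?_
    refine Primrec.to_comp ?_
    refine PrimrecPred.decide ?_
    exact Primrec.eq.comp (Primrec.nat_sub.comp (hpow.comp Primrec.snd) (Primrec.const 1))
      Primrec.fst
  have hlm : ∀ m, l (2 ^ m - 1) = Part.some m := by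
    intro m
    have hinj : ∀ k, 2 ^ k - 1 = 2 ^ m - 1 → k = m := by
      intro k hk
      have h1 := Nat.one_le_two_pow (n := m)
      have h2 := Nat.one_le_two_pow (n := k)
      exact Nat.pow_right_injective le_rfl (show 2 ^ k = 2 ^ m by omega)
    rw [Part.eq_some_iff]
    refine Nat.mem_rfind.2 ⟨by simp, fun {k} hk => ?_⟩
    have : ¬ (2 ^ k - 1 = 2 ^ m - 1) := fun h => hk.ne (hinj k h)
    simp [this]
  refine ⟨fun x => (l x).bind u, hl.bind (hu.comp Computable.snd), fun h => ?_⟩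
  refine ComputablePred.halting_problem 0 ?_
  obtain ⟨f, hf, hp⟩ := ComputablePred.computable_iff.1 h
  refine ComputablePred.computable_iff.2
    ⟨fun c => f (Encodable.encode c), hf.comp Computable.encode, ?_⟩
  funext c
  rw [← congrFun hp]
  simp [hlm, u]

open Turing in
/-- Restriction of a Turing machine to a finite set of states that supports it. -/
theorem Turing.TM0.exists_finite_of_supports {Γ Λ : Type} [Inhabited Γ] [Inhabited Λ]
    (M : TM0.Machine Γ Λ) (S : Finset Λ) (hS : TM0.Supports M ↑S) :
    ∃ (Q : Type) (_ : Finite Q) (_ : Inhabited Q) (N : TM0.Machine Γ Q),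
      ∀ l, (StateTransition.eval (TM0.step N) (TM0.init l)).Dom ↔
        (StateTransition.eval (TM0.step M) (TM0.init l)).Dom := by
  classical
  let : Inhabited S := ⟨⟨default, hS.1⟩⟩
  let idΓ : PointedMap Γ Γ := ⟨id, rfl⟩
  let g : PointedMap Λ S :=
    ⟨fun q => if h : q ∈ S then ⟨q, h⟩ else default, dif_pos hS.1⟩
  have hg : ∀ q ∈ (S : Set Λ), ((g q : S) : Λ) = q := by
    intro q hq
    have : g q = ⟨q, hq⟩ := dif_pos hq
    rw [this]
  refine ⟨S, inferInstance, inferInstance, M.map idΓ idΓ g Subtype.val, fun l => ?_⟩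
  refine StateTransition.tr_eval_dom
    (TM0.Machine.map_respects M idΓ idΓ g Subtype.val hS (fun _ => rfl) hg) ⟨hS.1, ?_⟩
  rw [TM0.map_init]
  congr 1
  exact List.map_id l

open Turing in
/-- A fixed finite Turing machine with undecidable halting problem on the inputs `x y ⋯ y`. -/
theorem Turing.TM0.exists_not_computablePred_eval_dom :
    ∃ (Γ Q : Type) (_ : Finite Γ) (_ : Finite Q) (_ : Inhabited Γ) (_ : Inhabited Q)
      (M : TM0.Machine Γ Q) (x y : Γ), ¬ ComputablePred fun m : ℕ =>
        (StateTransition.eval (TM0.step M) (TM0.init (x :: List.replicate m y))).Dom := by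
  classical
  obtain ⟨f, hf, hund⟩ := exists_partrec_not_computablePred_two_pow
  obtain ⟨c, hc⟩ := ToPartrec.Code.exists_code (Nat.Partrec'.part_iff₁.2 hf)
  -- The initial state of the stack machine is the entry point of the code `c`.
  let : Inhabited PartrecToTM2.Λ' :=
    ⟨PartrecToTM2.trNormal c PartrecToTM2.Cont'.halt⟩
  have h2 := PartrecToTM2.tr_supports c PartrecToTM2.Cont'.halt
  have h1 := TM2to1.tr_supports _ h2
  have h0 := TM1to0.tr_supports _ h1
  obtain ⟨Q, hQ, iQ, N, hN⟩ := TM0.exists_finite_of_supports _ _ h0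
  have : Finite PartrecToTM2.K' := by
    refine Finite.of_surjective
      (fun i : Fin 4 => ![PartrecToTM2.K'.main, .rev, .aux, .stack] i) fun k => ?_
    cases k
    exacts [⟨0, rfl⟩, ⟨1, rfl⟩, ⟨2, rfl⟩, ⟨3, rfl⟩]
  have hΓ : Finite (TM2to1.Γ' PartrecToTM2.K' fun _ => PartrecToTM2.Γ') := by
    unfold TM2to1.Γ'
    infer_instance
  obtain ⟨x, y, hxy⟩ := PartrecToTM2.exists_trInit_trList_two_pow_sub_one
  refine ⟨_, Q, hΓ, hQ, inferInstance, iQ, N, x, y, fun h => hund ?_⟩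
  have key : ∀ m, (StateTransition.eval (TM0.step N) (TM0.init (x :: List.replicate m y))).Dom ↔
      (f (2 ^ m - 1)).Dom := by
    intro m
    rw [← hxy, hN]
    have e1 : (f (2 ^ m - 1)).Dom ↔ (c.eval [2 ^ m - 1]).Dom := by
      have := hc ((2 ^ m - 1) ::ᵥ List.Vector.nil)
      rw [show ((2 ^ m - 1) ::ᵥ List.Vector.nil : List.Vector ℕ 1).1 = [2 ^ m - 1] from rfl] at this
      rw [this]
      exact Iff.rfl
    have e2 : (c.eval [2 ^ m - 1]).Dom ↔
        (StateTransition.eval (TM2.step PartrecToTM2.tr)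
          (PartrecToTM2.init c [2 ^ m - 1])).Dom := by
      rw [PartrecToTM2.tr_eval]
      exact Iff.rfl
    have e3 : PartrecToTM2.init c [2 ^ m - 1] =
        TM2.init PartrecToTM2.K'.main (PartrecToTM2.trList [2 ^ m - 1]) := by
      unfold PartrecToTM2.init TM2.init
      congr 1
      funext k
      cases k <;> simp [Function.update]
    rw [e1, e2, e3]
    refine Iff.trans ?_ (TM2to1.tr_eval_dom PartrecToTM2.tr PartrecToTM2.K'.main
      (PartrecToTM2.trList [2 ^ m - 1]))
    rw [← TM1to0.tr_eval]
    exact Iff.rfl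
  simpa only [key] using h

/-! ### A cellular automaton with undecidable symbol reachability -/

/-- The rows of the one-dimensional cellular automaton with local rule `g`, started in `r`. -/
def cellularRow {A : Type} (g : A → A → A → A) (r : ℤ → A) : ℕ → ℤ → A
  | 0 => r
  | t + 1 => fun p => g (cellularRow g r t (p - 1)) (cellularRow g r t p)
      (cellularRow g r t (p + 1))

theorem cellularRow_succ' {A : Type} (g : A → A → A → A) (r : ℤ → A) (t : ℕ) :
    cellularRow g r (t + 1) = cellularRow g (cellularRow g r 1) t := by
  induction t with
  | zero => rfl
  | succ t ih => rw [cellularRow, ih]; rfl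

/-- The row `⋯ z z x y ⋯ y z z ⋯` with `x` at position `0`, followed by `m` letters `y`. -/
def blockRow {A : Type} (x y z : A) (m : ℕ) (p : ℤ) : A :=
  if p = 0 then x else if 1 ≤ p ∧ p ≤ m then y else z

namespace Turing.TM0

variable {Γ Q : Type} [Inhabited Γ] [Inhabited Q]

/-- The local rule of the cellular automaton that simulates a Turing machine. A cell holds a tape
symbol and, if the head is there, the state of the machine. -/
def localRule (M : Machine Γ Q) (x y z : Γ × Option Q) : Γ × Option Q :=
  match y.2.bind fun q => M q y.1 with
  | some (q', Stmt.write a) => (a, some q')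
  | some (_, Stmt.move _) => (y.1, none)
  | none =>
    (y.1,
      match x.2.bind fun q => M q x.1 with
      | some (q', Stmt.move Dir.right) => some q'
      | _ =>
        match z.2.bind fun q => M q z.1 with
        | some (q', Stmt.move Dir.left) => some q'
        | _ => none)

/-- The row of cells that represents a configuration whose head is at position `h`. -/
def cfgRow (c : Cfg Γ Q) (h p : ℤ) : Γ × Option Q :=
  (c.Tape.nth (p - h), if p = h then some c.q else none)

theorem cfgRow_bind (M : Machine Γ Q) (c : Cfg Γ Q) (h p : ℤ) :
    ((cfgRow c h p).2.bind fun q => M q (cfgRow c h p).1) =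
      if p = h then M c.q c.Tape.head else none := by
  unfold cfgRow
  split_ifs with hp
  · simp [hp]
  · rfl

/-- The cellular automaton simulates one step of the machine; the head moves to `h'`. -/
theorem exists_localRule_cfgRow (M : Machine Γ Q) (c d : Cfg Γ Q) (h : ℤ)
    (hd : step M c = some d) :
    ∃ h', ∀ p, localRule M (cfgRow c h (p - 1)) (cfgRow c h p) (cfgRow c h (p + 1)) =
      cfgRow d h' p := by
  obtain ⟨q, T⟩ := c
  obtain ⟨⟨q', s⟩, hM, rfl⟩ := Option.map_eq_some_iff.1 hd
  -- The three cases are a move to the left, a move to the right, and a write command.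
  rcases s with (_ | _) | a
  · refine ⟨h - 1, fun p => ?_⟩
    unfold localRule
    simp only [cfgRow_bind, hM]
    unfold cfgRow
    simp only [Tape.move_left_nth]
    have e : p - (h - 1) - 1 = p - h := by ring
    rw [e]
    by_cases h1 : p = h
    · subst h1
      have h3 : ¬ p = p - 1 := by omega
      simp [h3]
    · by_cases h2 : p + 1 = h
      · have h3 : p = h - 1 := by omega
        subst h3; simp
      · have h3 : ¬ p = h - 1 := by omega
        by_cases h5 : p - 1 = h <;> simp [h1, h2, h3, h5]
  · refine ⟨h + 1, fun p => ?_⟩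
    unfold localRule
    simp only [cfgRow_bind, hM]
    unfold cfgRow
    simp only [Tape.move_right_nth]
    have e : p - (h + 1) + 1 = p - h := by ring
    rw [e]
    by_cases h1 : p = h
    · subst h1; simp
    · by_cases h2 : p - 1 = h
      · have h3 : p = h + 1 := by omega
        subst h3; simp
      · have h3 : ¬ p = h + 1 := by omega
        by_cases h5 : p + 1 = h <;> simp [h1, h2, h3, h5]
  · refine ⟨h, fun p => ?_⟩
    unfold localRule
    simp only [cfgRow_bind, hM]
    unfold cfgRow
    simp only [Tape.write_nth]
    by_cases h1 : p = h
    · subst h1; simp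
    · have h3 : ¬ p - h = 0 := by omega
      by_cases h5 : p + 1 = h
      · simp [h1, h3, h5]
      · by_cases h2 : p - 1 = h <;> simp [h1, h3, h5, h2]

/-- The cells at which the simulated machine halts. -/
def haltingCells (M : Machine Γ Q) : Set (Γ × Option Q) :=
  {s | ∃ q, s.2 = some q ∧ M q s.1 = none}

theorem cfgRow_init (x y : Γ) (m : ℕ) :
    cfgRow (init (x :: List.replicate m y) : Cfg Γ Q) 0 =
      blockRow (x, some default) (y, none) (default, none) m := by
  funext p
  unfold cfgRow blockRow init
  rcases p with (_ | n) | n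
  · simp
    rfl
  · have h : ¬ ((n : ℤ) + 1 = 0) := by omega
    have h' : (1 : ℤ) ≤ n + 1 := by omega
    have h'' : ((n : ℤ) + 1 ≤ m) = (n < m) := propext (by omega)
    have e : (Tape.mk₁ (x :: List.replicate m y)).nth ((n : ℤ) + 1) =
        (List.replicate m y).getI n := by
      refine (Tape.mk'_nth_nat _ _ (n + 1)).trans ?_
      rw [ListBlank.nth_mk, List.getI_cons_succ]
    simp only [Int.ofNat_eq_natCast, sub_zero, Nat.cast_add, Nat.cast_one, h, h', h'', true_and,
      if_false, e]
    split_ifs with hn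
    · rw [List.getI_eq_getElem _ (by simpa using hn), List.getElem_replicate]
    · rw [List.getI_eq_default _ (by simpa using hn)]
  · have h : ¬ (1 ≤ Int.negSucc n) := by omega
    have h' : ¬ (Int.negSucc n = 0) := by omega
    simp only [sub_zero, h, h', false_and, if_false]
    refine Prod.ext ?_ rfl
    exact (ListBlank.nth_mk [] n).trans (by simp)

/-- A halting cell occurs in the space-time diagram if and only if the machine halts. After the
machine has halted, the diagram has no meaning, but then a halting cell has occurred already. -/
theorem exists_cellularRow_mem_haltingCells_iff (M : Machine Γ Q) (c : Cfg Γ Q) (h : ℤ) :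
    (∃ t p, cellularRow (localRule M) (cfgRow c h) t p ∈ haltingCells M) ↔
      (StateTransition.eval (step M) c).Dom := by
  have hhalt : ∀ (d : Cfg Γ Q) (h p : ℤ), cfgRow d h p ∈ haltingCells M ↔
      p = h ∧ step M d = none := by
    rintro ⟨q, T⟩ h p
    unfold haltingCells cfgRow step
    by_cases hp : p = h <;> simp [hp]
  constructor
  · rintro ⟨t, p, ht⟩
    induction t generalizing c h with
    | zero =>
      rw [Part.dom_iff_mem]
      exact ⟨c, StateTransition.mem_eval.2 ⟨Relation.ReflTransGen.refl, ((hhalt c h p).1 ht).2⟩⟩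
    | succ t ih =>
      rcases hs : step M c with _ | d
      · exact Part.dom_iff_mem.2 ⟨c, StateTransition.mem_eval.2 ⟨Relation.ReflTransGen.refl, hs⟩⟩
      · obtain ⟨h', e⟩ := exists_localRule_cfgRow M c d h hs
        rw [StateTransition.reaches_eval (Relation.ReflTransGen.single hs)]
        refine ih d h' ?_
        have e' : cellularRow (localRule M) (cfgRow c h) 1 = cfgRow d h' := funext e
        rwa [cellularRow_succ', e'] at ht
  · intro hdom
    obtain ⟨b, hmem⟩ := Part.dom_iff_mem.1 hdom
    obtain ⟨hr, hb⟩ := StateTransition.mem_eval.1 hmem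
    suffices ∃ t h', cellularRow (localRule M) (cfgRow c h) t = cfgRow b h' by
      obtain ⟨t, h', e⟩ := this
      exact ⟨t, h', by rw [e]; exact (hhalt b h' h').2 ⟨rfl, hb⟩⟩
    clear hb hmem hdom hhalt
    induction hr with
    | refl => exact ⟨0, h, rfl⟩
    | tail _ hs ih =>
      obtain ⟨t, h', e⟩ := ih
      obtain ⟨h'', e'⟩ := exists_localRule_cfgRow M _ _ h' hs
      refine ⟨t + 1, h'', funext fun p => ?_⟩
      rw [← e' p, ← e]
      rfl

end Turing.TM0

/-- A fixed cellular automaton for which it is undecidable, given `m`, whether a symbol from `H`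
ever appears when it is started on the row with a block of length `m`. -/
theorem exists_cellularRow_not_computablePred :
    ∃ (A : Type) (_ : Finite A) (g : A → A → A → A) (H : Set A) (x y z : A),
      ¬ ComputablePred fun m : ℕ => ∃ t p, cellularRow g (blockRow x y z m) t p ∈ H := by
  obtain ⟨Γ, Q, _, _, _, _, M, x, y, h⟩ := Turing.TM0.exists_not_computablePred_eval_dom
  refine ⟨Γ × Option Q, inferInstance, Turing.TM0.localRule M, Turing.TM0.haltingCells M,
    (x, some default), (y, none), (default, none), ?_⟩
  simpa only [← Turing.TM0.cfgRow_init, Turing.TM0.exists_cellularRow_mem_haltingCells_iff] using h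

/-! ### Determinacy of the non-termination game -/

namespace GameArena

variable {V : Type} (A : GameArena V) (Γ : LoopGraph V)

/-- The configurations from which the universal player can force the play to get stuck: the
attractor of the stuck configurations. -/
inductive Losing : A.Conf Γ → Prop
  | ofExistential (c : A.Conf Γ) (hc : A.existential c.1 = true)
      (h : ∀ d, A.Step Γ c d → RightInvertible d.2 → Losing d) : Losing c
  | ofUniversal (c d : A.Conf Γ) (hc : A.existential c.1 = false) (hs : A.Step Γ c d)
      (hd : RightInvertible d.2) (h : Losing d) : Losing c
  | ofStuck (c : A.Conf Γ) (hc : A.existential c.1 = false)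
      (h : ∀ d, A.Step Γ c d → ¬ RightInvertible d.2) : Losing c

variable {A Γ}

theorem Step.eq_of_fst_eq {c d d' : A.Conf Γ} (h : A.Step Γ c d) (h' : A.Step Γ c d')
    (e : d.1 = d'.1) : d = d' := by
  obtain ⟨w, hw, h⟩ := h
  obtain ⟨w', hw', h'⟩ := h'
  rw [← e] at hw'
  obtain rfl := A.transition_unique _ _ _ _ hw hw'
  exact Prod.ext e (h.trans h'.symm)

theorem IsFinitePlay.concat {c b d : A.Conf Γ} {π : List (A.Conf Γ)}
    (h : A.IsFinitePlay Γ c (π ++ [b])) (hs : A.Step Γ b d) (hd : RightInvertible d.2) :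
    A.IsFinitePlay Γ c (π ++ [b] ++ [d]) := by
  obtain ⟨h1, h2, h3⟩ := h
  refine ⟨?_, ?_, ?_⟩
  · rw [List.head?_append, h1]; rfl
  · rw [List.isChain_append]
    refine ⟨h2, List.isChain_singleton _, ?_⟩
    simpa using hs
  · intro x hx
    rcases List.mem_append.1 hx with hx | hx
    · exact h3 x hx
    · rw [List.mem_singleton.1 hx]; exact hd

theorem IsFinitePlay.step_of_concat {c b d : A.Conf Γ} {π : List (A.Conf Γ)}
    (h : A.IsFinitePlay Γ c (π ++ [b] ++ [d])) : A.Step Γ b d ∧ RightInvertible d.2 := by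
  obtain ⟨h1, h2, h3⟩ := h
  refine ⟨?_, h3 d (by simp)⟩
  have := (List.isChain_append.1 h2).2.2
  simpa using this

theorem IsFinitePlay.of_concat {c b d : A.Conf Γ} {π : List (A.Conf Γ)}
    (h : A.IsFinitePlay Γ c (π ++ [b] ++ [d])) : A.IsFinitePlay Γ c (π ++ [b]) := by
  obtain ⟨h1, h2, h3⟩ := h
  refine ⟨?_, (List.isChain_append.1 h2).1, fun d hd => h3 d (List.mem_append_left _ hd)⟩
  rwa [List.head?_append_of_ne_nil _ (by simp)] at h1

theorem compliant_concat_iff {σ : List (Fin A.numStates) → Fin A.numStates} {b d : A.Conf Γ}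
    {π : List (A.Conf Γ)} :
    A.Compliant Γ σ (π ++ [b] ++ [d]) ↔ A.Compliant Γ σ (π ++ [b]) ∧
      (A.existential b.1 = true → σ ((π ++ [b]).map Prod.fst) = d.1) := by
  constructor
  · intro h
    refine ⟨fun h' x y hp => h h' x y (hp.trans (List.prefix_append _ _)), fun hb => ?_⟩
    exact h π b d (by simp) hb
  · rintro ⟨h, hb⟩ h' x y hp hx
    rcases List.prefix_concat_iff.1 hp with e | hp
    · have e1 : (h' ++ [x]) ++ [y] = (π ++ [b]) ++ [d] := by simpa using e
      obtain ⟨e2, e3⟩ := List.append_inj' e1 rfl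
      obtain ⟨e4, e5⟩ := List.append_inj' e2 rfl
      simp only [List.cons.injEq, and_true] at e3 e5
      subst e3 e4 e5
      exact hb hx
    · exact h h' x y hp hx

/-- A play compliant with a strategy that has reached a losing configuration shows that the strategy
is not winning, as the universal player can steer the continuation along the attractor. -/
theorem Losing.not_isWinningStrategy {c₀ c : A.Conf Γ}
    {σ : List (Fin A.numStates) → Fin A.numStates} (h : A.Losing Γ c) (π : List (A.Conf Γ))
    (hp : A.IsFinitePlay Γ c₀ (π ++ [c])) (hσ : A.Compliant Γ σ (π ++ [c])) :
    ¬ A.IsWinningStrategy Γ c₀ σ := by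
  intro hw
  induction h generalizing π with
  | ofExistential c hc h ih =>
    obtain ⟨d, hd, hd'⟩ := hw.2 _ hp hσ
    obtain ⟨hs, hv⟩ := hd.step_of_concat
    exact ih d hs hv _ hd hd'
  | ofUniversal c d hc hs hd h ih =>
    refine ih _ (hp.concat hs hd) (compliant_concat_iff.2 ⟨hσ, fun h => ?_⟩)
    rw [hc] at h
    exact absurd h Bool.false_ne_true
  | ofStuck c hc h =>
    obtain ⟨d, hd, hd'⟩ := hw.2 _ hp hσ
    obtain ⟨hs, hv⟩ := hd.step_of_concat
    exact h d hs hv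

variable (A Γ)

/-- One step of the reconstruction of a play from its states: the successor of `c` with state `q`,
and `c` itself if there is none. -/
noncomputable def follow (c : A.Conf Γ) (q : Fin A.numStates) : A.Conf Γ :=
  open Classical in if h : ∃ d, A.Step Γ c d ∧ d.1 = q then h.choose else c

/-- The strategy that moves to a successor which is not losing if there is one. The current
configuration is recovered from the states visited so far, as the transition between two states
is unique. At a sequence of states that does not come from a run, any successor is chosen. -/
noncomputable def safeStrategy (c₀ : A.Conf Γ) (l : List (Fin A.numStates)) : Fin A.numStates :=
  open Classical in
  if h : l.getLast? = some (l.tail.foldl (A.follow Γ) c₀).1 ∧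
      ∃ d, A.Step Γ (l.tail.foldl (A.follow Γ) c₀) d ∧ RightInvertible d.2 ∧ ¬ A.Losing Γ d
  then h.2.choose.1
  else
    match l.getLast? with
    | some q => (A.exists_transition q).choose_spec.choose
    | none => A.init

variable {A Γ}

theorem follow_eq {c d : A.Conf Γ} (h : A.Step Γ c d) : A.follow Γ c d.1 = d := by
  have hex : ∃ d', A.Step Γ c d' ∧ d'.1 = d.1 := ⟨d, h, rfl⟩
  rw [follow, dif_pos hex]
  exact hex.choose_spec.1.eq_of_fst_eq h hex.choose_spec.2

/-- The last configuration of a play can be recovered from its states. -/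
theorem foldl_follow_eq {c₀ c : A.Conf Γ} {π : List (A.Conf Γ)}
    (hp : A.IsFinitePlay Γ c₀ (π ++ [c])) :
    ((π ++ [c]).map Prod.fst).tail.foldl (A.follow Γ) c₀ = c := by
  induction π using List.reverseRecOn generalizing c with
  | nil =>
    have := hp.1
    simp at this
    simp [this]
  | append_singleton π b ih =>
    have hs := hp.step_of_concat.1
    have := ih hp.of_concat
    rw [List.map_append, List.tail_append_of_ne_nil (by simp), List.foldl_append, this]
    exact follow_eq hs

theorem isWinningStrategy_safeStrategy {c₀ : A.Conf Γ} (h₀ : ¬ A.Losing Γ c₀) :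
    A.IsWinningStrategy Γ c₀ (A.safeStrategy Γ c₀) := by
  classical
  -- From a configuration that is not losing, the strategy moves to one that is not losing either.
  have hmove : ∀ (π : List (A.Conf Γ)) (c : A.Conf Γ), A.IsFinitePlay Γ c₀ (π ++ [c]) →
      A.existential c.1 = true → ¬ A.Losing Γ c →
      ∃ d, A.Step Γ c d ∧ RightInvertible d.2 ∧ ¬ A.Losing Γ d ∧
        A.safeStrategy Γ c₀ ((π ++ [c]).map Prod.fst) = d.1 := by
    intro π c hp hc hl
    have hf := foldl_follow_eq hp
    have hex : ∃ d, A.Step Γ c d ∧ RightInvertible d.2 ∧ ¬ A.Losing Γ d := by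
      by_contra! hcon
      exact hl (Losing.ofExistential c hc hcon)
    have hcond : ((π ++ [c]).map Prod.fst).getLast? =
        some (((π ++ [c]).map Prod.fst).tail.foldl (A.follow Γ) c₀).1 ∧
        ∃ d, A.Step Γ (((π ++ [c]).map Prod.fst).tail.foldl (A.follow Γ) c₀) d ∧
          RightInvertible d.2 ∧ ¬ A.Losing Γ d := by
      rw [hf]
      exact ⟨by simp, hex⟩
    obtain ⟨h1, h2, h3⟩ := hcond.2.choose_spec
    refine ⟨hcond.2.choose, ?_, h2, h3, dif_pos hcond⟩
    generalize hcond.2.choose = d at h1 ⊢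
    rwa [hf] at h1
  have hsafe : ∀ (π : List (A.Conf Γ)) (c : A.Conf Γ), A.IsFinitePlay Γ c₀ (π ++ [c]) →
      A.Compliant Γ (A.safeStrategy Γ c₀) (π ++ [c]) → ¬ A.Losing Γ c := by
    intro π
    induction π using List.reverseRecOn with
    | nil =>
      intro c hp _
      have : c = c₀ := by simpa using hp.1
      rwa [this]
    | append_singleton π b ih =>
      intro c hp hσ
      obtain ⟨hσ, hb⟩ := compliant_concat_iff.1 hσ
      obtain ⟨hs, hv⟩ := hp.step_of_concat
      have hl := ih b hp.of_concat hσ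
      rcases hbb : A.existential b.1 with _ | _
      · exact fun h => hl (Losing.ofUniversal b c hbb hs hv h)
      · obtain ⟨d, hd, -, hd', e⟩ := hmove π b hp.of_concat hbb hl
        rwa [hs.eq_of_fst_eq hd ((hb hbb).symm.trans e)]
  refine ⟨fun h q hq => ?_, fun π hp hσ => ?_⟩
  · unfold safeStrategy
    split_ifs with hcond
    · obtain ⟨⟨w, hw, -⟩, -⟩ := hcond.2.choose_spec
      have e := hcond.1
      rw [List.getLast?_concat, Option.some.injEq] at e
      generalize hcond.2.choose = d at hw ⊢
      rw [← e] at hw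
      exact ⟨w, hw⟩
    · rw [List.getLast?_concat]
      exact ⟨_, (A.exists_transition q).choose_spec.choose_spec⟩
  · rcases List.eq_nil_or_concat' π with rfl | ⟨π, c, rfl⟩
    · exact absurd hp.1 (by simp)
    · have hl := hsafe π c hp hσ
      rcases hc : A.existential c.1 with _ | _
      · have hex : ∃ d, A.Step Γ c d ∧ RightInvertible d.2 := by
          by_contra! hcon
          exact hl (Losing.ofStuck c hc hcon)
        obtain ⟨d, hs, hd⟩ := hex
        refine ⟨d, hp.concat hs hd, compliant_concat_iff.2 ⟨hσ, fun h => ?_⟩⟩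
        rw [hc] at h
        exact absurd h Bool.false_ne_true
      · obtain ⟨d, hs, hd, -, e⟩ := hmove π c hp hc hl
        exact ⟨d, hp.concat hs hd, compliant_concat_iff.2 ⟨hσ, fun _ => e⟩⟩

/-- Determinacy of the non-termination game. -/
theorem existentialWins_iff : A.ExistentialWins Γ ↔ ¬ A.Losing Γ (A.init, 1) := by
  refine ⟨fun ⟨σ, hσ⟩ h => ?_, fun h => ⟨_, isWinningStrategy_safeStrategy h⟩⟩
  refine h.not_isWinningStrategy (c₀ := (A.init, 1)) (σ := σ) []
    ⟨rfl, List.isChain_singleton _, ?_⟩ ?_ hσ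
  · intro d hd
    rw [List.nil_append, List.mem_singleton] at hd
    subst hd
    exact ⟨1, one_mul 1⟩
  · intro h x y hp
    simpa using hp.length_le

end GameArena

/-! ### The graph monoid of a pushdown with entries in `ℤ²` -/

/-- The word `v ⋯ v` or `v̄ ⋯ v̄` of length `|n|` that represents the power `v ^ n` if `v` carries a
self-loop. -/
def zpowWord {V : Type} (v : V) (n : ℤ) : List (StorageLetter V) :=
  List.replicate n.toNat (v, true) ++ List.replicate (-n).toNat (v, false)

/-- The word over the letters of `1` and `2` that represents the vector `u`. -/
def vectorWord (u : ℤ × ℤ) : List (StorageLetter (Fin 3)) :=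
  zpowWord 1 u.1 ++ zpowWord 2 u.2

/-- The element of the graph monoid that represents the vector `u`. -/
def vectorElement (u : ℤ × ℤ) : GraphMonoid pdZ2Graph :=
  storageElement pdZ2Graph (vectorWord u)

section

variable {V : Type} (Γ : LoopGraph V)

theorem storageElement_append (w w' : List (StorageLetter V)) :
    storageElement Γ (w ++ w') = storageElement Γ w * storageElement Γ w' := by
  unfold storageElement
  rw [FreeMonoid.ofList_append, map_mul]

theorem storageElement_cons (l : StorageLetter V) (w : List (StorageLetter V)) :
    storageElement Γ (l :: w) = storageElement Γ [l] * storageElement Γ w :=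
  storageElement_append Γ [l] w

theorem storageElement_replicate (n : ℕ) (l : StorageLetter V) :
    storageElement Γ (List.replicate n l) = storageElement Γ [l] ^ n := by
  induction n with
  | zero => rfl
  | succ n ih => rw [List.replicate_succ, storageElement_cons, ih, pow_succ']

theorem storageElement_mul_bar (v : V) :
    storageElement Γ [(v, true)] * storageElement Γ [(v, false)] = 1 :=
  PresentedMonoid.mk_eq_mk_of_rel (GraphMonoidRel.cancel v)

variable {Γ}

theorem storageElement_comm {u v : V} (h : Γ.Adj u v) (s t : Bool) :
    storageElement Γ [(u, s)] * storageElement Γ [(v, t)] =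
      storageElement Γ [(v, t)] * storageElement Γ [(u, s)] :=
  PresentedMonoid.mk_eq_mk_of_rel (GraphMonoidRel.comm u v s t h)

/-- The letter of a vertex with a self-loop is a unit of the graph monoid. -/
def letterUnit {v : V} (h : Γ.Adj v v) : (GraphMonoid Γ)ˣ where
  val := storageElement Γ [(v, true)]
  inv := storageElement Γ [(v, false)]
  val_inv := storageElement_mul_bar Γ v
  inv_val := (storageElement_comm h false true).trans (storageElement_mul_bar Γ v)

theorem commute_letterUnit {u v : V} (hu : Γ.Adj u u) (hv : Γ.Adj v v) (h : Γ.Adj u v) :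
    Commute (letterUnit hu) (letterUnit hv) :=
  Units.ext (storageElement_comm h true true)

theorem storageElement_zpowWord {v : V} (h : Γ.Adj v v) (n : ℤ) :
    storageElement Γ (zpowWord v n) = ↑(letterUnit h ^ n) := by
  have e : letterUnit h ^ n = letterUnit h ^ n.toNat * (letterUnit h)⁻¹ ^ (-n).toNat := by
    rw [inv_pow, ← zpow_natCast, ← zpow_natCast, ← zpow_neg, ← zpow_add]
    congr 1
    omega
  rw [e, zpowWord, storageElement_append, storageElement_replicate, storageElement_replicate]
  rfl

end

theorem vectorElement_eq (u : ℤ × ℤ) : vectorElement u =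
    ↑(letterUnit (Γ := pdZ2Graph) (v := 1) ⟨by decide, by decide⟩ ^ u.1 *
      letterUnit (Γ := pdZ2Graph) (v := 2) ⟨by decide, by decide⟩ ^ u.2) := by
  rw [vectorElement, vectorWord, storageElement_append,
    storageElement_zpowWord (Γ := pdZ2Graph) (v := 1) ⟨by decide, by decide⟩,
    storageElement_zpowWord (Γ := pdZ2Graph) (v := 2) ⟨by decide, by decide⟩, Units.val_mul]

theorem vectorElement_add (u v : ℤ × ℤ) :
    vectorElement (u + v) = vectorElement u * vectorElement v := by
  simp only [vectorElement_eq, Prod.fst_add, Prod.snd_add]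
  rw [← Units.val_mul, zpow_add, zpow_add]
  congr 1
  refine Commute.mul_mul_mul_comm ?_ _ _
  have h : pdZ2Graph.Adj 1 2 := ⟨by decide, by decide⟩
  exact (commute_letterUnit _ _ h).zpow_zpow _ _

theorem vectorElement_zero : vectorElement 0 = 1 := rfl

/-- The element `a u` of the graph monoid: a stack with the single entry `u`. -/
def stackElement (u : ℤ × ℤ) : GraphMonoid pdZ2Graph :=
  storageElement pdZ2Graph [(0, true)] * vectorElement u

theorem stackElement_zero : stackElement 0 = storageElement pdZ2Graph [(0, true)] :=
  mul_one _

theorem stackElement_mul_vectorWord (u v : ℤ × ℤ) :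
    stackElement u * storageElement pdZ2Graph (vectorWord v) = stackElement (u + v) := by
  rw [stackElement, stackElement, vectorElement_add, mul_assoc]
  rfl

theorem stackElement_zero_mul_pop :
    stackElement 0 * storageElement pdZ2Graph [(0, false)] = 1 := by
  rw [stackElement_zero, storageElement_mul_bar]

theorem rightInvertible_stackElement (u : ℤ × ℤ) : RightInvertible (stackElement u) := by
  refine ⟨vectorElement (-u) * storageElement pdZ2Graph [(0, false)], ?_⟩
  rw [← mul_assoc, stackElement, mul_assoc _ (vectorElement u), ← vectorElement_add,
    add_neg_cancel, vectorElement_zero, mul_one, storageElement_mul_bar]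

/-- The effect of a letter on a pushdown whose entries are vectors, given by its top entry and the
list of the other entries: `0` pushes the vector `0`, its bar pops the top entry if that is `0`
and not the bottom entry, and the other letters change the top entry. -/
def pushdownStep : StorageLetter (Fin 3) → (ℤ × ℤ) × List (ℤ × ℤ) →
    Option ((ℤ × ℤ) × List (ℤ × ℤ))
  | (0, true), (t, r) => some (0, t :: r)
  | (0, false), (t, u :: r) => if t = 0 then some (u, r) else none
  | (0, false), (_, []) => none
  | (1, s), (t, r) => some (t + (if s then (1, 0) else (-1, 0)), r)
  | (2, s), (t, r) => some (t + (if s then (0, 1) else (0, -1)), r)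

/-- The effect of a word on a pushdown, where `none` stands for failure. -/
def pushdownRun (w : List (StorageLetter (Fin 3))) (o : Option ((ℤ × ℤ) × List (ℤ × ℤ))) :
    Option ((ℤ × ℤ) × List (ℤ × ℤ)) :=
  w.foldl (fun o l => o.bind (pushdownStep l)) o

theorem pushdownRun_append (w w' : List (StorageLetter (Fin 3)))
    (o : Option ((ℤ × ℤ) × List (ℤ × ℤ))) :
    pushdownRun (w ++ w') o = pushdownRun w' (pushdownRun w o) :=
  List.foldl_append

theorem pushdownRun_none (w : List (StorageLetter (Fin 3))) : pushdownRun w none = none := by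
  induction w with
  | nil => rfl
  | cons l w ih => exact ih

theorem exists_pushdownStep_eq {v : Fin 3} (hv : v ≠ 0) (s : Bool) :
    ∃ u : ℤ × ℤ, ∀ t r, pushdownStep (v, s) (t, r) = some (t + u, r) := by
  fin_cases v
  · exact absurd rfl hv
  · exact ⟨_, fun _ _ => rfl⟩
  · exact ⟨_, fun _ _ => rfl⟩

/-- The graph monoid acts on pushdowns: the effect of a word depends only on the element that it
represents. -/
theorem pushdownRun_congr {w w' : List (StorageLetter (Fin 3))}
    (h : storageElement pdZ2Graph w = storageElement pdZ2Graph w')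
    (o : Option ((ℤ × ℤ) × List (ℤ × ℤ))) : pushdownRun w o = pushdownRun w' o := by
  suffices ∀ x y : FreeMonoid (StorageLetter (Fin 3)), ConGen.Rel (GraphMonoidRel pdZ2Graph) x y →
      ∀ o, pushdownRun x.toList o = pushdownRun y.toList o from
    this _ _ (PresentedMonoid.mk_eq_mk_iff.1 h) o
  intro x y hxy
  induction hxy with
  | refl => exact fun _ => rfl
  | symm _ ih => exact fun o => (ih o).symm
  | trans _ _ ih₁ ih₂ => exact fun o => (ih₁ o).trans (ih₂ o)
  | mul _ _ ih₁ ih₂ =>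
    intro o
    rw [FreeMonoid.toList_mul, FreeMonoid.toList_mul, pushdownRun_append, pushdownRun_append, ih₁,
      ih₂]
  | of x y h =>
    intro o
    cases h with
    | cancel v =>
      rcases o with _ | ⟨t, r⟩
      · rfl
      · fin_cases v
        · rfl
        · simp [pushdownRun, pushdownStep, add_assoc]
        · simp [pushdownRun, pushdownStep, add_assoc]
    | comm u v s t h =>
      rcases o with _ | ⟨t', r⟩
      · rfl
      · obtain ⟨a, ha⟩ := exists_pushdownStep_eq h.1 s
        obtain ⟨b, hb⟩ := exists_pushdownStep_eq h.2 t
        simp [pushdownRun, ha, hb, add_right_comm]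

/-- A word that fails on some pushdown fails there with any continuation, whereas `1` does not. -/
theorem not_rightInvertible_of_pushdownRun_eq_none {w : List (StorageLetter (Fin 3))}
    {o : (ℤ × ℤ) × List (ℤ × ℤ)} (h : pushdownRun w (some o) = none) :
    ¬ RightInvertible (storageElement pdZ2Graph w) := by
  rintro ⟨y, hy⟩
  obtain ⟨w', rfl⟩ := PresentedMonoid.surjective_mk y
  have h' := pushdownRun_congr (w := w ++ w'.toList) (w' := [])
    ((storageElement_append pdZ2Graph w w'.toList).trans hy) (some o)
  rw [pushdownRun_append, h, pushdownRun_none] at h'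
  exact absurd h' (by simp [pushdownRun])

theorem not_rightInvertible_pop :
    ¬ RightInvertible (storageElement pdZ2Graph [(0, false)]) :=
  not_rightInvertible_of_pushdownRun_eq_none (o := (0, [])) rfl

theorem pushdownRun_vectorWord (u t : ℤ × ℤ) (r : List (ℤ × ℤ)) :
    pushdownRun (vectorWord u) (some (t, r)) = some (t + u, r) := by
  have hrep : ∀ (n : ℕ) (l : StorageLetter (Fin 3)) (a t : ℤ × ℤ),
      (∀ t, pushdownStep l (t, r) = some (t + a, r)) →
      pushdownRun (List.replicate n l) (some (t, r)) = some (t + n • a, r) := by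
    intro n l a t h
    induction n generalizing t with
    | zero => simp [pushdownRun]
    | succ n ih =>
      have h' : pushdownRun (List.replicate (n + 1) l) (some (t, r)) =
          pushdownRun (List.replicate n l) (pushdownStep l (t, r)) := rfl
      rw [h', h, ih, succ_nsmul', add_assoc]
  unfold vectorWord zpowWord
  simp only [pushdownRun_append]
  rw [hrep _ _ (1, 0) _ fun _ => rfl, hrep _ _ (-1, 0) _ fun _ => rfl,
    hrep _ _ (0, 1) _ fun _ => rfl, hrep _ _ (0, -1) _ fun _ => rfl]
  congr 2
  ext
  · simp; omega
  · simp; omega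

/-- The top entry of the pushdown can be popped only if it is `0`. -/
theorem rightInvertible_stackElement_mul_pop {u : ℤ × ℤ}
    (h : RightInvertible (stackElement u * storageElement pdZ2Graph [(0, false)])) : u = 0 := by
  by_contra hu
  have e : stackElement u * storageElement pdZ2Graph [(0, false)] =
      storageElement pdZ2Graph ((0, true) :: vectorWord u ++ [(0, false)]) := by
    rw [storageElement_append, storageElement_cons]
    rfl
  rw [e] at h
  refine not_rightInvertible_of_pushdownRun_eq_none (o := (0, [])) ?_ h
  rw [pushdownRun_append]
  change pushdownRun _ (pushdownRun (vectorWord u) (some (0, [0]))) = none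
  rw [pushdownRun_vectorWord, zero_add]
  exact if_neg hu

/-! ### Alternating vector addition systems as arenas -/

/-- The arena with at most one transition between two states given by a table of labels. -/
def GameArena.ofLabels {V : Type} (n : ℕ) (owner : Fin n → Bool)
    (label : Fin n → Fin n → Option (List (StorageLetter V))) (init : Fin n)
    (h : ∀ p, ∃ q w, label p q = some w) : GameArena V where
  numStates := n
  existential := owner
  transitions := (List.finRange n ×ˢ List.finRange n).filterMap fun pq =>
    (label pq.1 pq.2).map fun w => (pq.1, w, pq.2)
  init := init
  exists_transition p := by
    obtain ⟨q, w, hw⟩ := h p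
    exact ⟨w, q, List.mem_filterMap.2 ⟨(p, q), by simp, by simp [hw]⟩⟩
  transition_unique p q w w' hw hw' := by
    obtain ⟨pq, -, hw⟩ := List.mem_filterMap.1 hw
    obtain ⟨pq', -, hw'⟩ := List.mem_filterMap.1 hw'
    simp only [Option.map_eq_some_iff, Prod.mk.injEq] at hw hw'
    obtain ⟨v, hv, rfl, rfl, rfl⟩ := hw
    obtain ⟨v', hv', h1, rfl, h2⟩ := hw'
    rw [h1, h2, hv] at hv'
    exact Option.some.inj hv'

theorem GameArena.mem_transitions_ofLabels {V : Type} {n : ℕ} {owner : Fin n → Bool}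
    {label : Fin n → Fin n → Option (List (StorageLetter V))} {init : Fin n}
    {h : ∀ p, ∃ q w, label p q = some w} {p q : Fin n} {w : List (StorageLetter V)} :
    (p, w, q) ∈ (GameArena.ofLabels n owner label init h).transitions ↔ label p q = some w := by
  refine List.mem_filterMap.trans ⟨?_, fun hw => ⟨(p, q), by simp, by simp [hw]⟩⟩
  rintro ⟨pq, -, hw⟩
  simp only [Option.map_eq_some_iff, Prod.mk.injEq] at hw
  obtain ⟨v, hv, rfl, rfl, rfl⟩ := hw
  exact hv

/-- An alternating vector addition system over `ℤ²`. States with `isUniversal s = false` are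
existential; the universal ones must have an outgoing edge. There is at most one edge between two
states. -/
structure AlternatingSystem (S : Type) where
  isUniversal : S → Bool
  edge : S → S → Option (ℤ × ℤ)
  start : S
  final : S
  isUniversal_final : isUniversal final = false
  exists_edge : ∀ s, isUniversal s = true → ∃ s' u, edge s s' = some u

namespace AlternatingSystem

variable {S : Type} (𝒮 : AlternatingSystem S)

/-- A state and a vector are accepted if there is a finite tree of runs all of whose branches end
in the final state with the vector `0`. -/
inductive Accepts : S → ℤ × ℤ → Prop
  | final : Accepts 𝒮.final 0
  | existential (s s' : S) (u v : ℤ × ℤ) (hs : 𝒮.isUniversal s = false)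
      (he : 𝒮.edge s s' = some u) (h : Accepts s' (v + u)) : Accepts s v
  | universal (s : S) (v : ℤ × ℤ) (hs : 𝒮.isUniversal s = true)
      (h : ∀ s' u, 𝒮.edge s s' = some u → Accepts s' (v + u)) : Accepts s v

/-- The states of the arena of an alternating system: besides those of the system, a state from
which the first stack entry is pushed, a state in which the play gets stuck, as the bottom of the
stack would have to be popped, and a state in which the play idles forever. -/
inductive ArenaState (S : Type)
  | inner (s : S)
  | start
  | stuck
  | idle

/-- `ArenaState S` consists of the states in `S` and three more. -/
def ArenaState.equivSum (S : Type) : ArenaState S ≃ S ⊕ Fin 3 where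
  toFun
    | inner s => Sum.inl s
    | start => Sum.inr 0
    | stuck => Sum.inr 1
    | idle => Sum.inr 2
  invFun
    | Sum.inl s => inner s
    | Sum.inr 0 => start
    | Sum.inr 1 => stuck
    | Sum.inr 2 => idle
  left_inv q := by cases q <;> rfl
  right_inv q := by
    rcases q with s | i
    · rfl
    · fin_cases i <;> rfl

instance [Finite S] : Finite (ArenaState S) := Finite.of_equiv _ (ArenaState.equivSum S).symm

/-- The owners of the states: the universal player of the game plays the existential role of the
alternating system. -/
def arenaOwner : ArenaState S → Bool
  | .inner s => 𝒮.isUniversal s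
  | _ => false

open Classical in
/-- The labels of the transitions: an edge adds a vector to the single stack entry, and in the final
state this entry may be popped. The universal player may always escape to the idle state, where he
loses. -/
noncomputable def arenaLabel : ArenaState S → ArenaState S → Option (List (StorageLetter (Fin 3)))
  | .start, .inner s => if s = 𝒮.start then some [(0, true)] else none
  | .inner s, .inner s' => (𝒮.edge s s').map vectorWord
  | .inner s, .stuck => if s = 𝒮.final then some [(0, false)] else none
  | .inner s, .idle => if 𝒮.isUniversal s = false then some [] else none
  | .stuck, .stuck => some [(0, false)]
  | .idle, .idle => some []
  | _, _ => none

theorem exists_arenaLabel (q : ArenaState S) : ∃ q' w, 𝒮.arenaLabel q q' = some w := by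
  rcases q with s | _ | _ | _
  · rcases h : 𝒮.isUniversal s with _ | _
    · exact ⟨.idle, [], by simp [arenaLabel, h]⟩
    · obtain ⟨s', u, hu⟩ := 𝒮.exists_edge s h
      exact ⟨.inner s', vectorWord u, by simp [arenaLabel, hu]⟩
  · exact ⟨.inner 𝒮.start, [(0, true)], by simp [arenaLabel]⟩
  · exact ⟨.stuck, [(0, false)], rfl⟩
  · exact ⟨.idle, [], rfl⟩

/-- The arena of an alternating system, for an enumeration `e` of its states. -/
noncomputable def arena {n : ℕ} (e : ArenaState S ≃ Fin n) : GameArena (Fin 3) :=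
  GameArena.ofLabels n (fun p => 𝒮.arenaOwner (e.symm p))
    (fun p q => 𝒮.arenaLabel (e.symm p) (e.symm q)) (e .start) (by
      intro p
      obtain ⟨q, w, hw⟩ := 𝒮.exists_arenaLabel (e.symm p)
      exact ⟨e q, w, by simpa using hw⟩)

variable {𝒮} {n : ℕ} (e : ArenaState S ≃ Fin n)

theorem arena_existential (q : ArenaState S) :
    (𝒮.arena e).existential (e q) = 𝒮.arenaOwner q :=
  congrArg 𝒮.arenaOwner (e.symm_apply_apply q)

theorem arena_step_iff {q q' : ArenaState S} {x y : GraphMonoid pdZ2Graph} :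
    (𝒮.arena e).Step pdZ2Graph (e q, x) (e q', y) ↔
      ∃ w, 𝒮.arenaLabel q q' = some w ∧ y = x * storageElement pdZ2Graph w := by
  refine exists_congr fun w => and_congr_left' ?_
  refine GameArena.mem_transitions_ofLabels.trans ?_
  simp

theorem losing_of_accepts {s : S} {v : ℤ × ℤ} (h : 𝒮.Accepts s v) :
    (𝒮.arena e).Losing pdZ2Graph (e (.inner s), stackElement v) := by
  induction h with
  | final =>
    refine .ofUniversal _ (e .stuck, 1) ((arena_existential e _).trans 𝒮.isUniversal_final)
      ((arena_step_iff e).2 ⟨[(0, false)], if_pos rfl, stackElement_zero_mul_pop.symm⟩)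
      ⟨1, one_mul 1⟩ ?_
    refine .ofStuck _ (arena_existential e _) ?_
    rintro ⟨p, y⟩ hs
    obtain ⟨q, rfl⟩ := e.surjective p
    obtain ⟨w, hw, rfl⟩ := (arena_step_iff e).1 hs
    rcases q with s | _ | _ | _
    · exact absurd hw (by simp [arenaLabel])
    · exact absurd hw (by simp [arenaLabel])
    · obtain rfl := Option.some.inj hw
      simpa using not_rightInvertible_pop
    · exact absurd hw (by simp [arenaLabel])
  | existential s s' u v hs he h ih =>
    refine .ofUniversal _ (e (.inner s'), stackElement (v + u)) ((arena_existential e _).trans hs)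
      ((arena_step_iff e).2 ⟨vectorWord u, by simp [arenaLabel, he],
        (stackElement_mul_vectorWord v u).symm⟩) (rightInvertible_stackElement _) ih
  | universal s v hs h ih =>
    refine .ofExistential _ ((arena_existential e _).trans hs) ?_
    rintro ⟨p, y⟩ hstep hy
    obtain ⟨q, rfl⟩ := e.surjective p
    obtain ⟨w, hw, rfl⟩ := (arena_step_iff e).1 hstep
    rcases q with s' | _ | _ | _
    · obtain ⟨u, hu, rfl⟩ := Option.map_eq_some_iff.1 hw
      rw [stackElement_mul_vectorWord]
      exact ih s' u hu
    · exact absurd hw (by simp [arenaLabel])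
    · have hne : s ≠ 𝒮.final := by
        rintro rfl
        rw [𝒮.isUniversal_final] at hs
        exact Bool.false_ne_true hs
      exact absurd hw (by simp [arenaLabel, hne])
    · exact absurd hw (by simp [arenaLabel, hs])

variable (𝒮) in
/-- An invariant of the losing configurations of the arena. The idle state is losing at most for
storage contents that are not valid, so escaping to it does not help the universal player. -/
def LosingMeaning : ArenaState S → GraphMonoid pdZ2Graph → Prop
  | .inner s, x => ∀ v, x = stackElement v → 𝒮.Accepts s v
  | .idle, x => ¬ RightInvertible x
  | .start, x => x = 1 → 𝒮.Accepts 𝒮.start 0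
  | .stuck, _ => True

theorem losingMeaning_of_losing {c : (𝒮.arena e).Conf pdZ2Graph}
    (h : (𝒮.arena e).Losing pdZ2Graph c) : 𝒮.LosingMeaning (e.symm c.1) c.2 := by
  induction h with
  | ofExistential c hc h ih =>
    obtain ⟨p, x⟩ := c
    obtain ⟨q, rfl⟩ := e.surjective p
    rw [arena_existential] at hc
    rw [e.symm_apply_apply]
    rcases q with s | _ | _ | _
    · rintro v rfl
      refine .universal s v hc fun s' u hu => ?_
      have := ih (e (.inner s'), stackElement (v + u))
        ((arena_step_iff e).2 ⟨vectorWord u, by simp [arenaLabel, hu],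
          (stackElement_mul_vectorWord v u).symm⟩) (rightInvertible_stackElement _)
      rw [e.symm_apply_apply] at this
      exact this _ rfl
    all_goals exact absurd hc Bool.false_ne_true
  | ofUniversal c d hc hs hd h ih =>
    obtain ⟨p, x⟩ := c
    obtain ⟨q, rfl⟩ := e.surjective p
    obtain ⟨p', y⟩ := d
    obtain ⟨q', rfl⟩ := e.surjective p'
    rw [arena_existential] at hc
    rw [e.symm_apply_apply] at ih ⊢
    obtain ⟨w, hw, rfl⟩ := (arena_step_iff e).1 hs
    rcases q with s | _ | _ | _
    · rintro v rfl
      rcases q' with s' | _ | _ | _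
      · obtain ⟨u, hu, rfl⟩ := Option.map_eq_some_iff.1 hw
        exact .existential s s' u v hc hu (ih _ (stackElement_mul_vectorWord v u))
      · exact absurd hw (by simp [arenaLabel])
      · by_cases hf : s = 𝒮.final
        · obtain rfl := Option.some.inj ((if_pos hf).symm.trans hw)
          rw [rightInvertible_stackElement_mul_pop hd, hf]
          exact .final
        · exact absurd hw (by simp [arenaLabel, hf])
      · exact absurd hd ih
    · rintro rfl
      rcases q' with s' | _ | _ | _
      · by_cases hf : s' = 𝒮.start
        · obtain rfl := Option.some.inj ((if_pos hf).symm.trans hw)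
          rw [← hf]
          exact ih 0 ((one_mul _).trans stackElement_zero.symm)
        · exact absurd hw (by simp [arenaLabel, hf])
      all_goals exact absurd hw (by simp [arenaLabel])
    · trivial
    · rcases q' with s' | _ | _ | _
      iterate 3 exact absurd hw (by simp [arenaLabel])
      exact absurd hd ih
  | ofStuck c hc h =>
    obtain ⟨p, x⟩ := c
    obtain ⟨q, rfl⟩ := e.surjective p
    rw [arena_existential] at hc
    rw [e.symm_apply_apply]
    rcases q with s | _ | _ | _
    · rintro v rfl
      refine absurd (rightInvertible_stackElement v) (h (e .idle, stackElement v) ?_)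
      exact (arena_step_iff e).2 ⟨[], if_pos hc, (mul_one _).symm⟩
    · rintro rfl
      refine absurd (rightInvertible_stackElement 0) (h (e (.inner 𝒮.start), stackElement 0) ?_)
      exact (arena_step_iff e).2
        ⟨[(0, true)], if_pos rfl, stackElement_zero.trans (one_mul _).symm⟩
    · trivial
    · exact fun hx => h (e .idle, x) ((arena_step_iff e).2 ⟨[], rfl, (mul_one _).symm⟩) hx

/-- The arena of an alternating system is won by the existential player if and only if the system
rejects. -/
theorem existentialWins_arena_iff :
    (𝒮.arena e).ExistentialWins pdZ2Graph ↔ ¬ 𝒮.Accepts 𝒮.start 0 := by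
  rw [GameArena.existentialWins_iff, not_iff_not]
  constructor
  · intro h
    have := losingMeaning_of_losing e h
    rw [show (𝒮.arena e).init = e .start from rfl, e.symm_apply_apply] at this
    exact this rfl
  · intro h
    refine .ofUniversal _ (e (.inner 𝒮.start), stackElement 0) (arena_existential e .start)
      ((arena_step_iff e).2 ⟨[(0, true)], if_pos rfl, stackElement_zero.trans (one_mul _).symm⟩)
      (rightInvertible_stackElement 0) (losing_of_accepts e h)

end AlternatingSystem

/-! ### An alternating system that traces back a cellular automaton -/

/-- The states of the alternating system that traces back a cell of a cellular automaton with
symbols in `A`. The vector is a point `(t, p)` of the space-time diagram. The first three states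
serve to guess it, and the last four to verify that `t = 0` and that `p` lies in an interval. The
index `i` of a cell says at which place of a triple it is claimed; it keeps the edges from a triple
with repeated symbols apart. -/
inductive TraceState (A : Type)
  | pumpTime
  | pumpRight
  | pumpLeft
  | cell (i : Fin 3) (s : A)
  | triple (f : Fin 3 → A)
  | block
  | nonneg
  | nonpos
  | zero

/-- `TraceState A` consists of the cells, the triples and seven more states. -/
def TraceState.equivSum (A : Type) : TraceState A ≃ ((Fin 3 × A) ⊕ (Fin 3 → A)) ⊕ Fin 7 where
  toFun
    | cell i s => Sum.inl (Sum.inl (i, s))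
    | triple f => Sum.inl (Sum.inr f)
    | pumpTime => Sum.inr 0
    | pumpRight => Sum.inr 1
    | pumpLeft => Sum.inr 2
    | block => Sum.inr 3
    | nonneg => Sum.inr 4
    | nonpos => Sum.inr 5
    | zero => Sum.inr 6
  invFun
    | Sum.inl (Sum.inl (i, s)) => cell i s
    | Sum.inl (Sum.inr f) => triple f
    | Sum.inr 0 => pumpTime
    | Sum.inr 1 => pumpRight
    | Sum.inr 2 => pumpLeft
    | Sum.inr 3 => block
    | Sum.inr 4 => nonneg
    | Sum.inr 5 => nonpos
    | Sum.inr 6 => zero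
  left_inv q := by cases q <;> rfl
  right_inv q := by
    rcases q with (⟨i, s⟩ | f) | j
    · rfl
    · rfl
    · fin_cases j <;> rfl

instance {A : Type} [Finite A] : Finite (TraceState A) :=
  Finite.of_equiv _ (TraceState.equivSum A).symm

namespace TraceState

variable {A : Type} (g : A → A → A → A) (H : Set A) (x y z : A) (m : ℕ)

/-- The universal states, in which all of several claims have to be checked. -/
def isUniversal : TraceState A → Bool
  | triple _ => true
  | block => true
  | _ => false

open Classical in
/-- The edges: guess a point at which a symbol of `H` occurs; verify that the cell at a point
contains `s` by guessing the symbols of the three cells that determine it one time unit earlier,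
where all three guesses have to be verified; at time `0` compare with the initial row. -/
noncomputable def edge : TraceState A → TraceState A → Option (ℤ × ℤ)
  | pumpTime, pumpTime => some (1, 0)
  | pumpTime, pumpRight => some 0
  | pumpRight, pumpRight => some (0, 1)
  | pumpRight, pumpLeft => some 0
  | pumpLeft, pumpLeft => some (0, -1)
  | pumpLeft, cell i s => if i = 0 ∧ s ∈ H then some 0 else none
  | cell _ s, triple f => if g (f 0) (f 1) (f 2) = s then some 0 else none
  | triple f, cell i s => if f i = s then some (-1, (i : ℤ) - 1) else none
  | cell _ s, zero => if s = x then some 0 else none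
  | cell _ s, block => if s = y then some 0 else none
  | block, nonneg => some (0, -1)
  | block, nonpos => some (0, -(m : ℤ))
  | cell _ s, nonneg => if s = z then some (0, -((m + 1 : ℕ) : ℤ)) else none
  | cell _ s, nonpos => if s = z then some (0, 1) else none
  | nonneg, nonneg => some (0, -1)
  | nonneg, zero => some 0
  | nonpos, nonpos => some (0, 1)
  | nonpos, zero => some 0
  | _, _ => none

/-- The alternating system that accepts if and only if a symbol of `H` occurs in the space-time
diagram of the automaton with local rule `g` that is started on `blockRow x y z m`. -/
noncomputable def system : AlternatingSystem (TraceState A) where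
  isUniversal := isUniversal
  edge := edge g H x y z m
  start := pumpTime
  final := zero
  isUniversal_final := rfl
  exists_edge s hs := by
    cases s with
    | triple f => exact ⟨cell 0 (f 0), _, if_pos rfl⟩
    | block => exact ⟨nonneg, _, rfl⟩
    | _ => exact absurd hs Bool.false_ne_true

/-- The claim that the system verifies when it is in a given state with a given vector. While the
point is being guessed, the claim is that some symbol of `H` occurs at all. -/
def Claim : TraceState A → ℤ × ℤ → Prop
  | cell _ s, v => ∃ t : ℕ, v.1 = t ∧ cellularRow g (blockRow x y z m) t v.2 = s
  | triple f, v => ∃ t : ℕ, v.1 = t + 1 ∧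
      ∀ i : Fin 3, cellularRow g (blockRow x y z m) t (v.2 + ((i : ℤ) - 1)) = f i
  | block, v => v.1 = 0 ∧ 1 ≤ v.2 ∧ v.2 ≤ m
  | nonneg, v => v.1 = 0 ∧ 0 ≤ v.2
  | nonpos, v => v.1 = 0 ∧ v.2 ≤ 0
  | zero, v => v = 0
  | _, _ => ∃ t p, cellularRow g (blockRow x y z m) t p ∈ H

variable {g H x y z m}

theorem cellularRow_succ_eq {f : Fin 3 → A} {t : ℕ} {p : ℤ}
    (h : ∀ i : Fin 3, cellularRow g (blockRow x y z m) t (p + ((i : ℤ) - 1)) = f i) :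
    cellularRow g (blockRow x y z m) (t + 1) p = g (f 0) (f 1) (f 2) := by
  rw [← h 0, ← h 1, ← h 2]
  simp only [cellularRow]
  congr 2
  simp

/-- Soundness of the system. -/
theorem claim_of_accepts {s : TraceState A} {v : ℤ × ℤ} (h : (system g H x y z m).Accepts s v) :
    Claim g H x y z m s v := by
  induction h with
  | final => rfl
  | universal s v hs h ih =>
    cases s with
    | triple f => 
      have h0 := ih (cell 0 (f 0)) _ (if_pos rfl)
      have h1 := ih (cell 1 (f 1)) _ (if_pos rfl)
      have h2 := ih (cell 2 (f 2)) _ (if_pos rfl)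
      obtain ⟨t, ht, h0⟩ := h0
      obtain ⟨t', ht', h1⟩ := h1
      obtain ⟨t'', ht'', h2⟩ := h2
      simp only [Prod.fst_add] at ht ht' ht''
      obtain rfl : t' = t := by omega
      obtain rfl : t'' = t' := by omega
      refine ⟨t'', by omega, fun i => ?_⟩
      fin_cases i
      exacts [h0, h1, h2]
    | block =>
      obtain ⟨h1, h2⟩ := ih nonneg _ rfl
      obtain ⟨h3, h4⟩ := ih nonpos _ rfl
      simp only [Prod.fst_add, Prod.snd_add] at h1 h2 h3 h4
      exact ⟨by omega, by omega, by omega⟩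
    | _ => exact absurd hs Bool.false_ne_true
  | existential s s' u v hs he h ih =>
    change edge g H x y z m s s' = some u at he
    obtain ⟨v1, v2⟩ := v
    obtain ⟨u1, u2⟩ := u
    cases s with
    | pumpTime =>
      cases s' <;> simp [edge] at he
      all_goals exact ih
    | pumpRight =>
      cases s' <;> simp [edge] at he
      all_goals exact ih
    | pumpLeft =>
      cases s' <;> simp [edge] at he
      · exact ih
      · obtain ⟨t, -, ht⟩ := ih
        exact ⟨t, _, by rw [ht]; exact he.1.2⟩
    | cell i a =>
      cases s' <;> simp [edge, Prod.ext_iff] at he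
      all_goals obtain ⟨rfl, rfl, rfl⟩ := he
      · obtain ⟨t, ht, hf⟩ := ih
        simp only [Prod.fst_add, Prod.snd_add, add_zero] at ht hf
        exact ⟨t + 1, by simpa using ht, cellularRow_succ_eq hf⟩
      all_goals
        simp only [Claim, Prod.mk_add_mk, Prod.ext_iff, Prod.fst_zero, Prod.snd_zero] at ih
        refine ⟨0, by simpa using ih.1, ?_⟩
        simp only [cellularRow, blockRow]
      · rw [if_neg (by omega), if_pos (by omega)]
      · rw [if_neg (by omega), if_neg (by omega)]
      · rw [if_neg (by omega), if_neg (by omega)]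
      · rw [if_pos (by omega)]
    | triple f => exact absurd hs.symm Bool.false_ne_true
    | block => exact absurd hs.symm Bool.false_ne_true
    | zero => cases s' <;> simp [edge] at he
    | _ =>
      cases s' <;> simp [edge, Prod.ext_iff] at he
      all_goals
        obtain ⟨rfl, rfl⟩ := he
        simp only [Claim, Prod.mk_add_mk, Prod.ext_iff, Prod.fst_zero, Prod.snd_zero] at ih ⊢
        omega

theorem accepts_of_loop {s : TraceState A} {u v : ℤ × ℤ} (hs : isUniversal s = false)
    (he : edge g H x y z m s s = some u) (k : ℕ)
    (h : (system g H x y z m).Accepts s (v + k • u)) : (system g H x y z m).Accepts s v := by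
  induction k generalizing v with
  | zero => simpa using h
  | succ k ih =>
    refine .existential s s u v hs he (ih ?_)
    rwa [add_assoc, ← succ_nsmul']

theorem accepts_nonneg (k : ℕ) : (system g H x y z m).Accepts nonneg (0, k) := by
  refine accepts_of_loop (u := (0, -1)) rfl rfl k ?_
  refine .existential _ zero 0 _ rfl rfl ?_
  rw [show ((0, (k : ℤ)) : ℤ × ℤ) + k • (0, -1) + 0 = 0 by ext <;> simp]
  exact AlternatingSystem.Accepts.final

theorem accepts_nonpos (k : ℕ) : (system g H x y z m).Accepts nonpos (0, -(k : ℤ)) := by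
  refine accepts_of_loop (u := (0, 1)) rfl rfl k ?_
  refine .existential _ zero 0 _ rfl rfl ?_
  rw [show ((0, -(k : ℤ)) : ℤ × ℤ) + k • (0, 1) + 0 = 0 by ext <;> simp]
  exact AlternatingSystem.Accepts.final

/-- Completeness of the system for a single cell. -/
theorem accepts_cell (i : Fin 3) (t : ℕ) (p : ℤ) :
    (system g H x y z m).Accepts (cell i (cellularRow g (blockRow x y z m) t p)) (t, p) := by
  induction t generalizing p i with
  | zero =>
    simp only [cellularRow, blockRow, Nat.cast_zero]
    split_ifs with h0 h1
    · subst h0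
      refine .existential _ zero 0 _ rfl (if_pos rfl) ?_
      exact AlternatingSystem.Accepts.final
    · refine .existential _ block 0 _ rfl (if_pos rfl) ?_
      refine .universal _ _ rfl fun s' u hu => ?_
      change edge g H x y z m block s' = some u at hu
      cases s' <;> simp [edge] at hu <;> subst hu
      · convert accepts_nonneg (p - 1).toNat using 1
        ext <;> simp
        omega
      · convert accepts_nonpos (m - p).toNat using 1
        ext <;> simp
        omega
    · rcases lt_or_ge p 0 with hp | hp
      · refine .existential _ nonpos _ _ rfl (if_pos rfl) ?_
        convert accepts_nonpos (-(p + 1)).toNat using 1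
        ext <;> simp
        omega
      · refine .existential _ nonneg _ _ rfl (if_pos rfl) ?_
        convert accepts_nonneg (p - (m + 1)).toNat using 1
        ext <;> simp
        omega
  | succ t ih =>
    refine .existential _ (triple fun i => cellularRow g (blockRow x y z m) t (p + ((i : ℤ) - 1)))
      0 _ rfl (if_pos (cellularRow_succ_eq fun _ => rfl).symm) ?_
    refine .universal _ _ rfl fun s' u hu => ?_
    change edge g H x y z m (triple _) s' = some u at hu
    cases s' <;> simp [edge] at hu
    obtain ⟨rfl, rfl⟩ := hu
    convert ih _ _ using 1
    ext <;> simp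

/-- The system accepts if and only if a symbol of `H` occurs in the space-time diagram. -/
theorem accepts_start_iff : (system g H x y z m).Accepts (system g H x y z m).start 0 ↔
    ∃ t p, cellularRow g (blockRow x y z m) t p ∈ H := by
  refine ⟨fun h => claim_of_accepts h, ?_⟩
  rintro ⟨t, p, h⟩
  refine accepts_of_loop (u := (1, 0)) rfl rfl t ?_
  refine .existential _ pumpRight 0 _ rfl rfl ?_
  refine accepts_of_loop (u := (0, 1)) rfl rfl p.toNat ?_
  refine .existential _ pumpLeft 0 _ rfl rfl ?_
  refine accepts_of_loop (u := (0, -1)) rfl rfl (-p).toNat ?_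
  refine .existential _ (cell 0 _) 0 _ rfl (if_pos ⟨rfl, h⟩) ?_
  convert accepts_cell 0 t p using 1
  ext <;> simp
  omega

end TraceState

/-! ### Computability of the reduction -/

/-- The code of an arena given by a table of labels depends primitive recursively on a parameter
if every entry of the table does. -/
theorem GameArena.primrec_code_ofLabels {V : Type} [Primcodable V] (n : ℕ) (owner : Fin n → Bool)
    (label : ℕ → Fin n → Fin n → Option (List (StorageLetter V))) (init : Fin n)
    (h : ∀ m p, ∃ q w, label m p q = some w) (hl : ∀ p q, Primrec fun m => label m p q) :
    Primrec fun m => (GameArena.ofLabels n owner (label m) init (h m)).code := by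
  have key : ∀ L : List (Fin n × Fin n), Primrec fun m =>
      (L.filterMap fun pq => (label m pq.1 pq.2).map fun w => (pq.1, w, pq.2)).map
        fun t => ((t.1 : ℕ), t.2.1, (t.2.2 : ℕ)) := by
    intro L
    induction L with
    | nil => exact Primrec.const []
    | cons pq L ih =>
      have hcons : Primrec fun m => (label m pq.1 pq.2).elim
          ((L.filterMap fun pq => (label m pq.1 pq.2).map fun w => (pq.1, w, pq.2)).map
            fun t => ((t.1 : ℕ), t.2.1, (t.2.2 : ℕ)))
          fun w => ((pq.1 : ℕ), w, (pq.2 : ℕ)) ::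
            ((L.filterMap fun pq => (label m pq.1 pq.2).map fun w => (pq.1, w, pq.2)).map
              fun t => ((t.1 : ℕ), t.2.1, (t.2.2 : ℕ))) := by
        refine (Primrec.option_casesOn (hl pq.1 pq.2) ih (g := fun m w =>
          ((pq.1 : ℕ), w, (pq.2 : ℕ)) ::
            ((L.filterMap fun pq => (label m pq.1 pq.2).map fun w => (pq.1, w, pq.2)).map
              fun t => ((t.1 : ℕ), t.2.1, (t.2.2 : ℕ)))) ?_).of_eq fun m => ?_
        · exact Primrec.list_cons.comp
            (Primrec.pair (Primrec.const _) (Primrec.pair Primrec.snd (Primrec.const _)))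
            (ih.comp Primrec.fst)
        · cases label m pq.1 pq.2 <;> rfl
      refine hcons.of_eq fun m => ?_
      rcases hm : label m pq.1 pq.2 with _ | w <;> simp [hm]
  exact Primrec.pair (Primrec.const (List.ofFn owner))
    (Primrec.pair (key _) (Primrec.const (init : ℕ)))

theorem primrec_of_forall_eq_zero {α : Type} [Primcodable α] {f : ℕ → α} (h : ∀ m, f m = f 0) :
    Primrec f :=
  (Primrec.const (f 0)).of_eq fun m => (h m).symm

theorem primrec_replicate {α : Type} [Primcodable α] (a : α) :
    Primrec fun m => List.replicate m a := by
  refine (Primrec.list_map Primrec.list_range (f := List.range) (g := fun _ _ => a)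
    (Primrec.const a).to₂).of_eq fun m => ?_
  simp

theorem vectorWord_zero_neg (k : ℕ) : vectorWord (0, -(k : ℤ)) = List.replicate k (2, false) := by
  simp [vectorWord, zpowWord]

namespace TraceState

theorem primrec_arenaLabel {A : Type} (g : A → A → A → A) (H : Set A) (x y z : A)
    (q q' : AlternatingSystem.ArenaState (TraceState A)) :
    Primrec fun m => (system g H x y z m).arenaLabel q q' := by
  have hrep : Primrec fun m : ℕ => some (vectorWord (0, -(m : ℤ))) := by
    simp only [vectorWord_zero_neg]
    exact Primrec.option_some.comp (primrec_replicate _)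
  -- Only two labels depend on `m`.
  rcases q with s | _ | _ | _ <;> rcases q' with s' | _ | _ | _
  · cases s <;> cases s'
    case block.nonpos => exact hrep
    case cell.nonneg i a =>
      by_cases h : a = z
      · refine (hrep.comp Primrec.succ).of_eq fun m => ?_
        simp [AlternatingSystem.arenaLabel, system, edge, h]
      · refine (Primrec.const none).of_eq fun m => ?_
        simp [AlternatingSystem.arenaLabel, system, edge, h]
    all_goals exact primrec_of_forall_eq_zero fun _ => rfl
  all_goals exact primrec_of_forall_eq_zero fun _ => rfl

end TraceState

theorem mainTheorem10 : ¬ NonTerminationGamesDecidable pdZ2Graph := by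
  classical
  rintro ⟨f, hf, hdec⟩
  obtain ⟨A, _, g, H, x, y, z, hund⟩ := exists_cellularRow_not_computablePred
  obtain ⟨n, ⟨e⟩⟩ := Finite.exists_equiv_fin (AlternatingSystem.ArenaState (TraceState A))
  let arena (m : ℕ) : GameArena (Fin 3) := (TraceState.system g H x y z m).arena e
  have hcode : Computable fun m => (arena m).code :=
    (GameArena.primrec_code_ofLabels n
      (fun p => (TraceState.system g H x y z 0).arenaOwner (e.symm p))
      (fun m p q => (TraceState.system g H x y z m).arenaLabel (e.symm p) (e.symm q)) (e .start)
      (fun m p => (arena m).exists_transition p |>.elim fun w hw => hw.elim fun q hq =>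
        ⟨q, w, GameArena.mem_transitions_ofLabels.1 hq⟩)
      fun p q => TraceState.primrec_arenaLabel g H x y z (e.symm p) (e.symm q)).to_comp
  have hiff : ∀ m, f (arena m).code = true ↔ ¬ ∃ t p, cellularRow g (blockRow x y z m) t p ∈ H :=
    fun m => by
      rw [hdec, AlternatingSystem.existentialWins_arena_iff, TraceState.accepts_start_iff]
  refine hund (ComputablePred.computable_iff.2
    ⟨fun m => !f (arena m).code, Primrec.not.to_comp.comp (hf.comp hcode), ?_⟩)
  funext m
  rw [Bool.not_eq_true', ← Bool.not_eq_true, hiff, not_not]
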